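/- Let $k\ge 6$ and $d\ge 3$ be integers, and let $G$ be a finite simple $k$-regular graph of girth $2d$ and excess $4$, i.e. whose number of vertices is $n=2\left(1+(k-1)+\dots+(k-1)^{d-1}\right)+4$. Let $A$ be the adjacency matrix of $G$, and let $E$ be its excess matrix: the real $n\times n$ matrix, indexed by the vertices of $G$, with $E_{u,v}=1$ if the distance between $u$ and $v$ in $G$ equals $d+1$, and $E_{u,v}=0$ otherwise. Define polynomials $H_m(x)$ by $H_0(x)=1$, $H_1(x)=x$ and $H_{m+1}(x)=xH_m(x)-(k-1)H_{m-1}(x)$ for $m\ge 1$ (the Dickson polynomials of the second kind with parameter $k-1$). Then: 1. for every eigenvalue $\mu$ of $A$ with $\mu\ne k$ and $\mu\neq -k$ there is an eigenvalue $\lambda$ of $E$ such that $H_{d-1}(\mu)=-\lambda$; 2. $E$ is a polynomial in $A$ with real coefficients; 3. every eigenvector of $A$ is an eigenvector of $E$. -/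

import Mathlib

/-- A `(k, g)`-graph: a `k`-regular graph of girth `g`. -/
structure IsKGGraph {V : Type*} [Fintype V] (G : SimpleGraph V) [DecidableRel G.Adj]
    (k g : ℕ) : Prop where
  regular : G.IsRegularOfDegree k
  egirth_eq : G.egirth = (g : ℕ∞)

/-- The Moore bound `M(k, g)`: it is `1 + k + k(k-1) + ⋯ + k(k-1)^((g-3)/2)` for odd `g`
and `2 (1 + (k-1) + ⋯ + (k-1)^((g-2)/2))` for even `g`. -/
def mooreBound (k g : ℕ) : ℤ :=
  if Odd g then 1 + ∑ i ∈ Finset.range ((g - 1) / 2), (k : ℤ) * ((k : ℤ) - 1) ^ i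
  else 2 * ∑ i ∈ Finset.range (g / 2), ((k : ℤ) - 1) ^ i

/-- A `(k, g)`-graph of excess `e`: the order of the graph exceeds the Moore bound by `e`. -/
structure IsKGGraphOfExcess {V : Type*} [Fintype V] (G : SimpleGraph V) [DecidableRel G.Adj]
    (k g : ℕ) (e : ℤ) : Prop extends IsKGGraph G k g where
  excess_eq : (Fintype.card V : ℤ) - mooreBound k g = e

open Classical in
/-- The `i`-distance matrix of `G`: the entry at `(u, v)` is `1` if `u` and `v` are at
distance exactly `i`, and `0` otherwise. -/
noncomputable def distanceMatrix {V : Type*} (G : SimpleGraph V) (i : ℕ) : Matrix V V ℝ :=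
  Matrix.of fun u v => if G.edist u v = (i : ℕ∞) then 1 else 0

/-- The excess matrix of a graph of girth `2 * d`: the `(d + 1)`-distance matrix. -/
noncomputable def excessMatrix {V : Type*} (G : SimpleGraph V) (d : ℕ) : Matrix V V ℝ :=
  distanceMatrix G (d + 1)

/-- `H_m`, the Dickson polynomial of the second kind of degree `m` with parameter `k - 1`. -/
noncomputable def polyH (k m : ℕ) : Polynomial ℝ :=
  Polynomial.dickson 2 ((k : ℝ) - 1) m

theorem polyH_zero (k : ℕ) : polyH k 0 = 1 := by
  simp only [polyH, Polynomial.dickson_zero]; norm_num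

theorem polyH_one (k : ℕ) : polyH k 1 = Polynomial.X := by
  simp [polyH]

theorem polyH_add_two (k m : ℕ) :
    polyH k (m + 2) =
      Polynomial.X * polyH k (m + 1) - Polynomial.C ((k : ℝ) - 1) * polyH k m := by
  simp [polyH]

/-!
Below half the girth two vertices are joined by at most one short path, so `H_{d-1}(A)` is the
`0`-`1` indicator of the pairs whose distance is at most `d - 1` and has the parity of `d - 1`.
Its row sums show that an edge `xy` has exactly `e` vertices at distance at least `d` from both
ends, where `e` is the excess. If `e ≤ k - 2`, each vertex has a neighbor outside this set, so the
diameter is at most `d + 1`.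

The graph is moreover bipartite, as Biggs and Ito observed. A vertex `u` with
`dist u x = dist u y` for an edge `xy` has both distances equal to `d`. Let `p` and `q` be the
next vertices on geodesics from `u` to `x` and to `y`. Each neighbor of `u` that is not closer to
`x` or `y` than `u` is far from `xy`, while `p` (resp. `q`) has at least as many far neighbors as
`u` has neighbors closer to `y` (resp. `x`); these three sets overlap in at most one vertex, so at
least `k - 1` vertices are far from `xy`, contradicting `e ≤ k - 2`.

Let `s` be the sign vector of the bipartition. Distances in `{0, …, d + 1}` of the parity of
`d + 1` are either at most `d - 1` or equal to `d + 1`, so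
`E + H_{d-1}(A) = (J + (-1)^(d+1) s sᵀ) / 2`. By connectedness the eigenvalues `k` and `-k` are
simple, spanned by `1` and `s`, so the right-hand side vanishes on all other eigenvectors of `A`.
-/

open Finset SimpleGraph Matrix

section Geodesics

variable {V : Type*} {G : SimpleGraph V} {u v w w' : V}

theorem egirth_le_length_add_length {p q : G.Walk u v} (hp : p.IsPath) (hq : q.IsPath)
    (hne : p ≠ q) : G.egirth ≤ (p.length + q.length : ℕ) := by
  obtain ⟨_, _, _, c, hc, hle⟩ := hp.exists_isCycle_length_le_add_of_ne hq hne
  exact (egirth_le_length hc).trans (by exact_mod_cast hle)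

theorem dist_le_dist_add_one_of_adj (huw : G.Adj u w) : G.dist u v ≤ G.dist w v + 1 := by
  have := huw.diff_dist_adj (u := v)
  rw [dist_comm (u := v), dist_comm (u := v)] at this
  lia

theorem exists_isPath_cons_length_eq_dist (huw : G.Adj u w) (hr : G.Reachable w v)
    (hle : G.dist w v ≤ G.dist u v) :
    ∃ q : G.Walk w v, (Walk.cons huw q).IsPath ∧ q.length = G.dist w v := by
  classical
  obtain ⟨q, hq, hlen⟩ := hr.exists_path_of_dist
  refine ⟨q, (Walk.cons_isPath_iff huw q).2 ⟨hq, fun hu => ?_⟩, hlen⟩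
  have hdrop : G.dist u v ≤ (q.dropUntil u hu).length := dist_le _
  have hsplit := congrArg Walk.length (q.take_spec hu)
  rw [Walk.length_append] at hsplit
  exact huw.ne (Walk.eq_of_length_eq_zero (p := q.takeUntil u hu) (by lia)).symm

theorem egirth_le_of_adj_of_dist_eq (huw : G.Adj u w) (hr : G.Reachable u v)
    (heq : G.dist u v = G.dist w v) : G.egirth ≤ (2 * G.dist u v + 1 : ℕ) := by
  obtain ⟨p, hp, hpl⟩ := hr.exists_path_of_dist
  obtain ⟨q, hq, hql⟩ :=
    exists_isPath_cons_length_eq_dist huw (huw.symm.reachable.trans hr) heq.ge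
  have hlen : (Walk.cons huw q).length = G.dist u v + 1 := by rw [Walk.length_cons, hql, heq]
  have hne : p ≠ Walk.cons huw q := fun h => by
    have := congrArg Walk.length h
    lia
  convert egirth_le_length_add_length hp hq hne using 2
  lia

theorem egirth_le_of_adj_of_dist_add_one_eq (huw : G.Adj u w) (huw' : G.Adj u w') (hne : w ≠ w')
    (hw : G.dist w v + 1 = G.dist u v) (hw' : G.dist w' v + 1 = G.dist u v) :
    G.egirth ≤ (2 * G.dist u v : ℕ) := by
  have hr : G.Reachable u v := Reachable.of_dist_ne_zero (by lia)
  obtain ⟨p, hp, hpl⟩ :=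
    exists_isPath_cons_length_eq_dist huw (huw.symm.reachable.trans hr) (by lia)
  obtain ⟨q, hq, hql⟩ :=
    exists_isPath_cons_length_eq_dist huw' (huw'.symm.reachable.trans hr) (by lia)
  have hpq : Walk.cons huw p ≠ Walk.cons huw' q := fun h => hne (by
    simpa only [Walk.snd_cons] using congrArg Walk.snd h)
  convert egirth_le_length_add_length hp hq hpq using 2
  simp only [Walk.length_cons]
  lia

theorem dist_add_one_eq_or_of_lt {d : ℕ} (huw : G.Adj u w) (hr : G.Reachable u v)
    (hg : (2 * d : ℕ) ≤ G.egirth) (hlt : G.dist u v < d) :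
    G.dist w v + 1 = G.dist u v ∨ G.dist w v = G.dist u v + 1 := by
  have hne : G.dist u v ≠ G.dist w v := fun h => by
    have : 2 * d ≤ 2 * G.dist u v + 1 := by
      exact_mod_cast hg.trans (egirth_le_of_adj_of_dist_eq huw hr h)
    lia
  have := dist_le_dist_add_one_of_adj (v := v) huw
  have := dist_le_dist_add_one_of_adj (v := v) huw.symm
  lia

theorem le_dist_of_adj_of_dist_eq {d : ℕ} {x y : V} (hxy : G.Adj x y) (hr : G.Reachable u x)
    (hg : (2 * d : ℕ) ≤ G.egirth) (heq : G.dist u x = G.dist u y) : d ≤ G.dist u x := by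
  by_contra! hlt
  rw [dist_comm] at hlt
  have := dist_add_one_eq_or_of_lt hxy hr.symm hg hlt
  rw [dist_comm, dist_comm (u := x)] at this
  lia

theorem exists_adj_dist_add_one_eq (hr : G.Reachable u v) (hne : u ≠ v) :
    ∃ w, G.Adj u w ∧ G.dist w v + 1 = G.dist u v := by
  obtain ⟨p, hp⟩ := hr.exists_walk_length_eq_dist
  cases p with
  | nil => exact absurd rfl hne
  | @cons _ w _ huw q =>
    have hq : G.dist w v ≤ q.length := dist_le q
    have hle : G.dist u v ≤ G.dist w v + 1 := dist_le_dist_add_one_of_adj huw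
    rw [Walk.length_cons] at hp
    exact ⟨w, huw, by lia⟩

theorem edist_lt_natCast_iff {n : ℕ} :
    G.edist u v < n ↔ G.Reachable u v ∧ G.dist u v < n := by
  refine ⟨fun h => ?_, fun ⟨hr, h⟩ => by rwa [← hr.coe_dist_eq_edist, Nat.cast_lt]⟩
  have hr := reachable_of_edist_ne_top h.ne_top
  exact ⟨hr, by rwa [← hr.coe_dist_eq_edist, Nat.cast_lt] at h⟩

theorem edist_le_natCast_iff {n : ℕ} :
    G.edist u v ≤ n ↔ G.Reachable u v ∧ G.dist u v ≤ n := by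
  rw [← Nat.lt_add_one_iff, ← edist_lt_natCast_iff, Nat.cast_add, Nat.cast_one,
    ENat.lt_add_one_iff (ENat.natCast_ne_top n)]

end Geodesics

section CloserNeighbors

variable {V : Type*} [Fintype V] (G : SimpleGraph V) [DecidableRel G.Adj] {u v w : V}

/-- The neighbors of `u` that lie one step closer to `v` than `u` does. Nothing is one step closer
to an unreachable `v`, since `SimpleGraph.dist` is then `0`. -/
noncomputable def closerNeighbors (u v : V) : Finset V :=
  {w ∈ G.neighborFinset u | G.dist w v + 1 = G.dist u v}

variable {G}

theorem mem_closerNeighbors :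
    w ∈ closerNeighbors G u v ↔ G.Adj u w ∧ G.dist w v + 1 = G.dist u v := by
  rw [closerNeighbors, mem_filter, mem_neighborFinset]

theorem closerNeighbors_nonempty (hr : G.Reachable u v) (hne : u ≠ v) :
    (closerNeighbors G u v).Nonempty :=
  let ⟨w, hw⟩ := exists_adj_dist_add_one_eq hr hne
  ⟨w, mem_closerNeighbors.2 hw⟩

theorem card_closerNeighbors_le_one (hg : (2 * G.dist u v : ℕ) < G.egirth) :
    #(closerNeighbors G u v) ≤ 1 := by
  refine card_le_one.2 fun w hw w' hw' => ?_
  rw [mem_closerNeighbors] at hw hw'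
  by_contra hne
  exact (egirth_le_of_adj_of_dist_add_one_eq hw.1 hw'.1 hne hw.2 hw'.2).not_gt hg

theorem card_closerNeighbors_eq_one (hr : G.Reachable u v) (hne : u ≠ v)
    (hg : (2 * G.dist u v : ℕ) < G.egirth) : #(closerNeighbors G u v) = 1 :=
  (card_closerNeighbors_le_one hg).antisymm (closerNeighbors_nonempty hr hne).card_pos

end CloserNeighbors

section PolyH

theorem eval_polyH_natCast (k m : ℕ) :
    (polyH k m).eval (k : ℝ) = ∑ i ∈ range (m + 1), ((k : ℝ) - 1) ^ i := by
  induction m using Nat.twoStepInduction with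
  | zero => simp [polyH_zero]
  | one => simp [polyH_one, sum_range_succ]
  | more m h0 h1 =>
    rw [polyH_add_two, Polynomial.eval_sub, Polynomial.eval_mul, Polynomial.eval_mul,
      Polynomial.eval_X, Polynomial.eval_C, h0, h1, sum_range_succ _ (m + 2),
      sum_range_succ _ (m + 1)]
    ring

variable {V : Type*} [Fintype V] {G : SimpleGraph V} [DecidableRel G.Adj] {k m : ℕ}

/-- The three-term recurrence holds because each pair at distance at most `m` is counted once for
each of the `k` neighbors of `u`, and each pair at distance `m + 2` once. -/
theorem sum_neighborFinset_dist_indicator (hreg : G.IsRegularOfDegree k)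
    (hg : (2 * (m + 2) : ℕ) < G.egirth) (u v : V) :
    ∑ w ∈ G.neighborFinset u,
        (if G.edist w v ≤ (m + 1 : ℕ) ∧ G.dist w v % 2 = (m + 1) % 2 then (1 : ℝ) else 0) =
      (if G.edist u v ≤ (m + 2 : ℕ) ∧ G.dist u v % 2 = (m + 2) % 2 then 1 else 0) +
        ((k : ℝ) - 1) * (if G.edist u v ≤ m ∧ G.dist u v % 2 = m % 2 then 1 else 0) := by
  classical
  simp only [edist_le_natCast_iff]
  by_cases hr : G.Reachable u v
  swap
  · have hrw : ∀ w ∈ G.neighborFinset u, ¬G.Reachable w v := fun w hw h =>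
      hr (((mem_neighborFinset _ _ _).1 hw).reachable.trans h)
    rw [sum_eq_zero fun w hw => if_neg fun h => hrw w hw h.1.1, if_neg fun h => hr h.1.1,
      if_neg fun h => hr h.1.1, mul_zero, add_zero]
  have hstep : ∀ w ∈ G.neighborFinset u, G.Reachable w v ∧ G.dist u v ≤ G.dist w v + 1 ∧
      (G.dist u v ≤ m + 1 → G.dist w v + 1 = G.dist u v ∨ G.dist w v = G.dist u v + 1) := by
    intro w hw
    rw [mem_neighborFinset] at hw
    refine ⟨hw.symm.reachable.trans hr, dist_le_dist_add_one_of_adj hw, fun hle => ?_⟩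
    exact dist_add_one_eq_or_of_lt hw hr hg.le (by lia)
  simp only [hr, true_and]
  by_cases hle : G.dist u v ≤ m ∧ G.dist u v % 2 = m % 2
  · rw [if_pos hle, if_pos (by lia), sum_congr rfl fun w hw => if_pos (by grind), sum_const,
      card_neighborFinset_eq_degree, hreg u, nsmul_one]
    ring
  rw [if_neg hle, mul_zero, add_zero]
  by_cases heq : G.dist u v = m + 2
  · have hone : #(closerNeighbors G u v) = 1 :=
      card_closerNeighbors_eq_one hr (fun h => by simp [h] at heq) (by rwa [heq])
    rw [if_pos (by lia), sum_boole,
      filter_congr (q := fun w => G.dist w v + 1 = G.dist u v) (by grind), ← closerNeighbors, hone,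
      Nat.cast_one]
  · rw [if_neg (by lia), sum_eq_zero fun w hw => if_neg (by grind)]

/-- `H_m` of the adjacency matrix counts the non-backtracking walks of length `m`,
`m - 2`, `m - 4`, …; below half the girth there is at most one of them between two vertices. -/
theorem aeval_polyH_adjMatrix_apply [DecidableEq V] (hreg : G.IsRegularOfDegree k)
    (hg : (2 * m : ℕ) < G.egirth) (u v : V) :
    Polynomial.aeval (G.adjMatrix ℝ) (polyH k m) u v =
      if G.edist u v ≤ m ∧ G.dist u v % 2 = m % 2 then 1 else 0 := by
  induction m using Nat.twoStepInduction generalizing u v with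
  | zero =>
    rw [polyH_zero, map_one, Matrix.one_apply]
    refine if_congr ?_ rfl rfl
    rw [Nat.cast_zero, nonpos_iff_eq_zero, edist_eq_zero_iff]
    exact ⟨fun h => ⟨h, by rw [h, dist_self]⟩, And.left⟩
  | one =>
    rw [polyH_one, Polynomial.aeval_X, adjMatrix_apply]
    refine if_congr ?_ rfl rfl
    rw [edist_le_natCast_iff, ← dist_eq_one_iff_adj]
    exact ⟨fun h => ⟨⟨Reachable.of_dist_ne_zero (by lia), by lia⟩, by lia⟩, by lia⟩
  | more m h0 h1 =>
    have hlt : ∀ i ≤ m + 2, ((2 * i : ℕ) : ℕ∞) < G.egirth := fun i hi =>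
      lt_of_le_of_lt (by exact_mod_cast by lia) hg
    rw [polyH_add_two, map_sub, map_mul, map_mul, Polynomial.aeval_X, Polynomial.aeval_C,
      ← Algebra.smul_def, Matrix.sub_apply, Matrix.smul_apply, adjMatrix_mul_apply,
      sum_congr rfl fun w _ => h1 (hlt _ (by lia)) w v, h0 (hlt _ (by lia)),
      sum_neighborFinset_dist_indicator hreg hg, smul_eq_mul]
    ring

end PolyH

theorem aeval_mulVec_eq_smul {n R : Type*} [Fintype n] [DecidableEq n] [CommRing R]
    {A : Matrix n n R} {μ : R} {v : n → R} (h : A *ᵥ v = μ • v) (p : Polynomial R) :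
    Polynomial.aeval A p *ᵥ v = p.eval μ • v := by
  have := Module.End.aeval_apply_of_mem_apply_eq_smul (f := Matrix.toLinAlgEquiv' A) (p := p) h
  rwa [Polynomial.aeval_algHom_apply] at this

section FarFromEdge

variable {V : Type*} [Fintype V] (G : SimpleGraph V) (d : ℕ)

open Classical in
/-- The vertices at distance at least `d` from both `x` and `y`, those of other components
included, which is why the definition uses `SimpleGraph.edist`. For an edge `xy` of a graph of
girth `2 * d` these are the vertices not counted by the Moore bound. -/
noncomputable def farFromEdge (x y : V) : Finset V :=
  {z | (d : ℕ∞) ≤ G.edist x z ∧ (d : ℕ∞) ≤ G.edist y z}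

variable {G d} {x y z : V}

theorem mem_farFromEdge :
    z ∈ farFromEdge G d x y ↔ (d : ℕ∞) ≤ G.edist x z ∧ (d : ℕ∞) ≤ G.edist y z := by
  simp only [farFromEdge, mem_filter, mem_univ, true_and]

theorem farFromEdge_comm (x y : V) : farFromEdge G d x y = farFromEdge G d y x := by
  ext z
  rw [mem_farFromEdge, mem_farFromEdge, and_comm]

theorem mem_farFromEdge_iff_dist (hconn : G.Preconnected) :
    z ∈ farFromEdge G d x y ↔ d ≤ G.dist z x ∧ d ≤ G.dist z y := by
  rw [mem_farFromEdge, ← (hconn x z).coe_dist_eq_edist, ← (hconn y z).coe_dist_eq_edist,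
    Nat.cast_le, Nat.cast_le, dist_comm, dist_comm (u := y)]

theorem notMem_farFromEdge :
    z ∉ farFromEdge G d x y ↔ G.edist x z < d ∨ G.edist y z < d := by
  rw [mem_farFromEdge, not_and_or, not_le, not_le]

end FarFromEdge

section Counting

variable {V : Type*} [Fintype V] {G : SimpleGraph V} [DecidableRel G.Adj] {k d : ℕ} {x y : V}

theorem adjMatrix_mulVec_one_of_regular (hreg : G.IsRegularOfDegree k) :
    G.adjMatrix ℝ *ᵥ 1 = (k : ℝ) • 1 := by
  ext u
  rw [← Function.const_one, adjMatrix_mulVec_const_apply_of_regular hreg, Pi.smul_apply,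
    smul_eq_mul, Function.const]

theorem sum_aeval_adjMatrix_apply [DecidableEq V] (hreg : G.IsRegularOfDegree k)
    (p : Polynomial ℝ) (u : V) :
    ∑ v, Polynomial.aeval (G.adjMatrix ℝ) p u v = p.eval (k : ℝ) := by
  simpa [mulVec, dotProduct] using
    congrFun (aeval_mulVec_eq_smul (adjMatrix_mulVec_one_of_regular hreg) p) u

open Classical in
/-- The ball around the edge splits into the vertices whose distance to `x`, respectively to `y`,
is at most `d - 1` and has the parity of `d - 1`. -/
theorem aeval_polyH_apply_add_of_adj (hreg : G.IsRegularOfDegree k)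
    (hd : 0 < d) (hg : (2 * d : ℕ) ≤ G.egirth) (hxy : G.Adj x y) (z : V) :
    Polynomial.aeval (G.adjMatrix ℝ) (polyH k (d - 1)) x z +
        Polynomial.aeval (G.adjMatrix ℝ) (polyH k (d - 1)) y z +
      (if z ∈ farFromEdge G d x y then 1 else 0) = 1 := by
  have hlt : ((2 * (d - 1) : ℕ) : ℕ∞) < G.egirth :=
    lt_of_lt_of_le (by exact_mod_cast by lia) hg
  rw [aeval_polyH_adjMatrix_apply hreg hlt, aeval_polyH_adjMatrix_apply hreg hlt]
  simp only [edist_le_natCast_iff]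
  by_cases hz : z ∈ farFromEdge G d x y
  · rw [if_pos hz]
    rw [mem_farFromEdge, ← not_lt, ← not_lt, edist_lt_natCast_iff, edist_lt_natCast_iff] at hz
    rw [if_neg (by grind), if_neg (by grind), add_zero, zero_add]
  rw [if_neg hz]
  rw [notMem_farFromEdge, edist_lt_natCast_iff, edist_lt_natCast_iff] at hz
  have hxz : G.Reachable x z := hz.elim And.left fun h => hxy.reachable.trans h.1
  have hyz : G.Reachable y z := hxy.symm.reachable.trans hxz
  have hpar : G.dist x z + 1 = G.dist y z ∨ G.dist y z + 1 = G.dist x z := by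
    rcases hz with ⟨-, hlt⟩ | ⟨-, hlt⟩
    · have := dist_add_one_eq_or_of_lt hxy hxz hg hlt
      lia
    · have := dist_add_one_eq_or_of_lt hxy.symm hyz hg hlt
      lia
  simp only [hxz, hyz, true_and]
  split_ifs <;> first | lia | norm_num

theorem card_eq_add_card_farFromEdge (hreg : G.IsRegularOfDegree k) (hd : 0 < d)
    (hg : (2 * d : ℕ) ≤ G.egirth) (hxy : G.Adj x y) :
    (Fintype.card V : ℝ) =
      2 * ∑ i ∈ range d, ((k : ℝ) - 1) ^ i + #(farFromEdge G d x y) := by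
  classical
  have hsum := sum_congr rfl fun z (_ : z ∈ univ) =>
    aeval_polyH_apply_add_of_adj hreg hd hg hxy z
  rw [sum_add_distrib, sum_add_distrib, sum_aeval_adjMatrix_apply hreg,
    sum_aeval_adjMatrix_apply hreg, eval_polyH_natCast, Nat.sub_add_cancel hd, sum_boole,
    filter_mem_eq_inter, univ_inter, sum_const, card_univ, nsmul_one] at hsum
  rw [← hsum]
  ring

end Counting

theorem IsKGGraphOfExcess.card_farFromEdge {V : Type*} [Fintype V] {G : SimpleGraph V}
    [DecidableRel G.Adj] {k d : ℕ} {e : ℤ} {x y : V} (hG : IsKGGraphOfExcess G k (2 * d) e)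
    (hd : 0 < d) (hxy : G.Adj x y) : (#(farFromEdge G d x y) : ℤ) = e := by
  have hcard := card_eq_add_card_farFromEdge hG.regular hd hG.egirth_eq.ge hxy
  have hmoore : mooreBound k (2 * d) = 2 * ∑ i ∈ range d, ((k : ℤ) - 1) ^ i := by
    rw [mooreBound, if_neg (Nat.not_odd_iff_even.2 (even_two_mul d)),
      Nat.mul_div_cancel_left d two_pos]
  rw [← hG.excess_eq, hmoore, eq_sub_iff_add_eq']
  exact_mod_cast hcard.symm

section Diameter

variable {V : Type*} [Fintype V] {G : SimpleGraph V} [DecidableRel G.Adj] {k d : ℕ} {x y : V}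

theorem exists_adj_notMem_farFromEdge (hreg : G.IsRegularOfDegree k)
    (hfar : #(farFromEdge G d x y) < k) (u : V) : ∃ p, G.Adj u p ∧ p ∉ farFromEdge G d x y := by
  rw [← hreg u, ← card_neighborFinset_eq_degree] at hfar
  obtain ⟨p, hp, hpfar⟩ := exists_mem_notMem_of_card_lt_card hfar
  exact ⟨p, (mem_neighborFinset _ _ _).1 hp, hpfar⟩

theorem edist_le_of_card_farFromEdge_lt (hreg : G.IsRegularOfDegree k) (hxy : G.Adj x y)
    (hfar : #(farFromEdge G d x y) < k) (u : V) : G.edist u x ≤ (d + 1 : ℕ) := by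
  obtain ⟨p, hup, hp⟩ := exists_adj_notMem_farFromEdge hreg hfar u
  rw [notMem_farFromEdge, edist_lt_natCast_iff, edist_lt_natCast_iff] at hp
  have hpx : G.Reachable x p ∧ G.dist x p ≤ d := by
    rcases hp with ⟨hr, hlt⟩ | ⟨hr, hlt⟩
    · exact ⟨hr, hlt.le⟩
    · exact ⟨hxy.reachable.trans hr, (dist_le_dist_add_one_of_adj hxy).trans hlt⟩
  rw [edist_le_natCast_iff]
  refine ⟨hup.reachable.trans hpx.1.symm, (dist_le_dist_add_one_of_adj hup).trans ?_⟩
  rw [dist_comm]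
  exact Nat.add_le_add_right hpx.2 1

end Diameter

section Bipartite

variable {V : Type*} [Fintype V] {G : SimpleGraph V} [DecidableRel G.Adj] {k d : ℕ}
  {u v p q x y : V}

/-- On a geodesic from `u` to `v` the last vertex `s` before `v` determines the first step, since
`dist u s` is less than half the girth; so mapping first steps to last steps is injective. -/
theorem card_closerNeighbors_le_card_closerNeighbors (hg : (2 * G.dist u v : ℕ) ≤ G.egirth)
    (h2 : 2 ≤ G.dist u v) : #(closerNeighbors G u v) ≤ #(closerNeighbors G v u) := by
  have hr : G.Reachable u v := Reachable.of_dist_ne_zero (by lia)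
  refine card_le_card_of_forall_subsingleton (fun t s => G.dist t s + 2 = G.dist u v) ?_ ?_
  · intro t ht
    rw [mem_closerNeighbors] at ht
    have hne : v ≠ t := by
      rintro rfl
      rw [dist_self] at ht
      lia
    obtain ⟨s, hs, hst⟩ := exists_adj_dist_add_one_eq (hr.symm.trans ht.1.reachable) hne
    rw [dist_comm, dist_comm (u := v)] at hst
    have hsu : G.dist s u ≤ G.dist t s + 1 := by
      rw [dist_comm]
      exact dist_le_dist_add_one_of_adj ht.1
    have hvu : G.dist v u ≤ G.dist s u + 1 := dist_le_dist_add_one_of_adj hs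
    rw [dist_comm] at hvu
    refine ⟨s, mem_closerNeighbors.2 ⟨hs, ?_⟩, by lia⟩
    rw [dist_comm (u := v)]
    lia
  · rintro s hs t ⟨ht, hts⟩ t' ⟨ht', hts'⟩
    rw [mem_closerNeighbors] at hs ht ht'
    rw [dist_comm, dist_comm (u := v)] at hs
    refine card_le_one.1 (card_closerNeighbors_le_one (G := G) (u := u) (v := s) ?_) t
      (mem_closerNeighbors.2 ⟨ht.1, by lia⟩) t' (mem_closerNeighbors.2 ⟨ht'.1, by lia⟩)
    exact lt_of_lt_of_le (by exact_mod_cast by lia) hg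

theorem card_closerNeighbors_comm (hg : (2 * G.dist u v : ℕ) ≤ G.egirth)
    (h2 : 2 ≤ G.dist u v) : #(closerNeighbors G u v) = #(closerNeighbors G v u) :=
  (card_closerNeighbors_le_card_closerNeighbors hg h2).antisymm <|
    card_closerNeighbors_le_card_closerNeighbors (by rwa [dist_comm]) (by rwa [dist_comm])

theorem card_closerNeighbors_add_le_degree (hg : (2 * d : ℕ) ≤ G.egirth) (hd : 2 ≤ d)
    (hup : G.Adj u p) (hu : G.dist u y = d) (hp : G.dist p y = d) :
    #(closerNeighbors G u y) + #(closerNeighbors G p y) ≤ G.degree y := by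
  classical
  have hdisj : Disjoint (closerNeighbors G y u) (closerNeighbors G y p) := by
    refine disjoint_left.2 fun s hsu hsp => ?_
    rw [mem_closerNeighbors, dist_comm, dist_comm (u := y)] at hsu hsp
    have hr : G.Reachable u s :=
      (Reachable.of_dist_ne_zero (v := y) (by lia)).trans hsu.1.reachable
    have := dist_add_one_eq_or_of_lt hup hr hg (by lia)
    lia
  calc #(closerNeighbors G u y) + #(closerNeighbors G p y)
      = #(closerNeighbors G y u) + #(closerNeighbors G y p) := by
        rw [card_closerNeighbors_comm (u := u) (by rwa [hu]) (by lia),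
          card_closerNeighbors_comm (u := p) (by rwa [hp]) (by lia)]
    _ = #(closerNeighbors G y u ∪ closerNeighbors G y p) := (card_union_of_disjoint hdisj).symm
    _ ≤ #(G.neighborFinset y) :=
        card_le_card (union_subset (filter_subset _ _) (filter_subset _ _))
    _ = G.degree y := card_neighborFinset_eq_degree _ _

theorem disjoint_neighborFinset_of_adj (hg : (4 : ℕ) ≤ G.egirth) (hpq : G.Adj p q) :
    Disjoint (G.neighborFinset p) (G.neighborFinset q) := by
  refine disjoint_left.2 fun t hp hq => ?_
  rw [mem_neighborFinset, ← dist_eq_one_iff_adj] at hp hq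
  have hle := hg.trans (egirth_le_of_adj_of_dist_eq hpq
    (Reachable.of_dist_ne_zero (by lia)) (hp.trans hq.symm))
  rw [hp] at hle
  exact absurd hle (by decide)

theorem dist_eq_of_dist_eq_of_adj (hconn : G.Preconnected) (hreg : G.IsRegularOfDegree k)
    (hg : (2 * d : ℕ) ≤ G.egirth) (hxy : G.Adj x y) (hfar : #(farFromEdge G d x y) < k)
    (heq : G.dist u x = G.dist u y) : G.dist u x = d := by
  obtain ⟨w, huw, hw⟩ := exists_adj_notMem_farFromEdge hreg hfar u
  rw [mem_farFromEdge_iff_dist hconn] at hw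
  have := dist_le_dist_add_one_of_adj (v := x) huw
  have := dist_le_dist_add_one_of_adj (v := y) huw
  have := le_dist_of_adj_of_dist_eq hxy (hconn u x) hg heq
  lia

theorem card_closerNeighbors_le_card_inter_farFromEdge [DecidableEq V]
    (hconn : G.Preconnected) (hreg : G.IsRegularOfDegree k) (hg : (2 * d : ℕ) ≤ G.egirth)
    (hd : 2 ≤ d) (hxy : G.Adj x y) (hx : G.dist u x = d) (hy : G.dist u y = d)
    (hp : p ∈ closerNeighbors G u x) :
    #(closerNeighbors G u y) ≤ #(G.neighborFinset p ∩ farFromEdge G d x y) := by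
  rw [mem_closerNeighbors] at hp
  have hpy : G.dist p y = d := by
    have := dist_le_dist_add_one_of_adj (v := y) hp.1
    have := hxy.diff_dist_adj (u := p)
    have := le_dist_of_adj_of_dist_eq hxy (hconn p x) hg
    lia
  have hsub : G.neighborFinset p \ closerNeighbors G p y ⊆
      G.neighborFinset p ∩ farFromEdge G d x y := by
    intro w hw
    rw [mem_sdiff, mem_closerNeighbors, mem_neighborFinset] at hw
    rw [mem_inter, mem_neighborFinset, mem_farFromEdge_iff_dist hconn]
    have hwx := dist_add_one_eq_or_of_lt hw.1 (hconn p x) hg (by lia)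
    have hwy := dist_le_dist_add_one_of_adj (v := y) hw.1
    have hxy := hxy.diff_dist_adj (u := w)
    grind
  have hsum := card_closerNeighbors_add_le_degree hg hd hp.1 hy hpy
  have hcard := (le_card_sdiff (closerNeighbors G p y) (G.neighborFinset p)).trans
    (card_le_card hsub)
  rw [card_neighborFinset_eq_degree, hreg p] at hcard
  rw [hreg y] at hsum
  lia

theorem card_neighborFinset_inter_neighborFinset_le_one [DecidableEq V]
    (hg : (4 : ℕ) < G.egirth) (hne : p ≠ q) : #(G.neighborFinset p ∩ G.neighborFinset q) ≤ 1 := by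
  refine card_le_one.2 fun s hs t ht => ?_
  simp only [mem_inter, mem_neighborFinset] at hs ht
  by_contra hst
  have hle := egirth_le_length_add_length
    (p := .cons hs.1 (.cons hs.2.symm .nil)) (q := .cons ht.1 (.cons ht.2.symm .nil))
    (by simp [hne, hs.1.ne, hs.2.ne']) (by simp [hne, ht.1.ne, ht.2.ne']) (by simp [hst])
  exact hle.not_gt hg

theorem card_inter_neighborFinset_add_le [DecidableEq V] (hg : (4 : ℕ) < G.egirth)
    (hup : G.Adj u p) (huq : G.Adj u q) (hne : p ≠ q) (X : Finset V) :
    #(G.neighborFinset u ∩ X) + #(G.neighborFinset p ∩ X) + #(G.neighborFinset q ∩ X) ≤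
      #X + 1 := by
  have hdisj : Disjoint (G.neighborFinset u ∩ X)
      (G.neighborFinset p ∩ X ∪ G.neighborFinset q ∩ X) := by
    rw [disjoint_union_right]
    exact ⟨(disjoint_neighborFinset_of_adj hg.le hup).mono inter_subset_left inter_subset_left,
      (disjoint_neighborFinset_of_adj hg.le huq).mono inter_subset_left inter_subset_left⟩
  have hinter : #((G.neighborFinset p ∩ X) ∩ (G.neighborFinset q ∩ X)) ≤ 1 :=
    (card_le_card (inter_subset_inter inter_subset_left inter_subset_left)).trans
      (card_neighborFinset_inter_neighborFinset_le_one hg hne)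
  have hunion := card_le_card (union_subset (inter_subset_right (s₁ := G.neighborFinset u))
    (union_subset (inter_subset_right (s₁ := G.neighborFinset p) (s₂ := X))
      (inter_subset_right (s₁ := G.neighborFinset q))))
  rw [card_union_of_disjoint hdisj] at hunion
  have := card_union_add_card_inter (G.neighborFinset p ∩ X) (G.neighborFinset q ∩ X)
  lia

theorem degree_le_card_closerNeighbors_add [DecidableEq V] (hconn : G.Preconnected)
    (hx : G.dist u x = d) (hy : G.dist u y = d) :
    G.degree u ≤ #(closerNeighbors G u x) + #(closerNeighbors G u y) +
      #(G.neighborFinset u ∩ farFromEdge G d x y) := by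
  have hcover : G.neighborFinset u ⊆ closerNeighbors G u x ∪ closerNeighbors G u y ∪
      (G.neighborFinset u ∩ farFromEdge G d x y) := by
    intro w hw
    have hwx := dist_le_dist_add_one_of_adj (v := x) ((mem_neighborFinset _ _ _).1 hw)
    have hwy := dist_le_dist_add_one_of_adj (v := y) ((mem_neighborFinset _ _ _).1 hw)
    simp only [mem_union, mem_inter, mem_closerNeighbors, mem_farFromEdge_iff_dist hconn]
    rw [mem_neighborFinset] at hw ⊢
    grind
  rw [← card_neighborFinset_eq_degree]
  exact (card_le_card hcover).trans <|
    (card_union_le _ _).trans <| Nat.add_le_add_right (card_union_le _ _) _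

theorem dist_ne_dist_of_adj_of_card_farFromEdge_lt (hconn : G.Preconnected)
    (hreg : G.IsRegularOfDegree k) (hg : (2 * d : ℕ) ≤ G.egirth) (hd : 3 ≤ d)
    (hxy : G.Adj x y) (hfar : #(farFromEdge G d x y) + 1 < k) (u : V) :
    G.dist u x ≠ G.dist u y := by
  classical
  intro heq
  have hux : G.dist u x = d := dist_eq_of_dist_eq_of_adj hconn hreg hg hxy (by lia) heq
  have huy : G.dist u y = d := heq ▸ hux
  have hne (t : V) (ht : G.dist u t = d) : u ≠ t := by
    rintro rfl
    rw [dist_self] at ht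
    lia
  obtain ⟨p, hp⟩ := closerNeighbors_nonempty (hconn u x) (hne x hux)
  obtain ⟨q, hq⟩ := closerNeighbors_nonempty (hconn u y) (hne y huy)
  have hcardx := card_closerNeighbors_le_card_inter_farFromEdge hconn hreg hg (by lia) hxy hux
    huy hp
  have hcardy := card_closerNeighbors_le_card_inter_farFromEdge hconn hreg hg (by lia) hxy.symm
    huy hux hq
  rw [farFromEdge_comm] at hcardy
  rw [mem_closerNeighbors] at hp hq
  have hpq : p ≠ q := by
    rintro rfl
    have := le_dist_of_adj_of_dist_eq hxy (hconn p x) hg (by lia)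
    lia
  have hsum := card_inter_neighborFinset_add_le (lt_of_lt_of_le (by exact_mod_cast by lia) hg)
    hp.1 hq.1 hpq (farFromEdge G d x y)
  have hdeg := degree_le_card_closerNeighbors_add hconn hux huy
  rw [hreg u] at hdeg
  lia

end Bipartite

section BipartiteSign

variable {V : Type*}

/-- The `±1`-vector of a proper `2`-coloring of `G`, real-valued so that matrices act on it. -/
structure IsBipartiteSign (G : SimpleGraph V) (s : V → ℝ) : Prop where
  mul_self : ∀ u, s u * s u = 1
  eq_neg_of_adj : ∀ {u v}, G.Adj u v → s v = -s u

namespace IsBipartiteSign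

variable {G : SimpleGraph V} {s : V → ℝ}

theorem neg_one_pow_dist {r : V} (hr : ∀ u v, G.Adj u v → G.dist r u ≠ G.dist r v) :
    IsBipartiteSign G fun u => (-1) ^ G.dist r u where
  mul_self u := by rw [← mul_pow, neg_one_mul, neg_neg, one_pow]
  eq_neg_of_adj {u v} huv := by
    have hstep : G.dist r v = G.dist r u + 1 ∨ G.dist r u = G.dist r v + 1 := by
      have := huv.diff_dist_adj (u := r)
      have := hr u v huv
      lia
    rcases hstep with h | h <;> rw [h, pow_succ] <;> ring

theorem apply_mul_apply (hs : IsBipartiteSign G s) {u v : V} (p : G.Walk u v) :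
    s u * s v = (-1) ^ p.length := by
  induction p with
  | nil => rw [hs.mul_self, Walk.length_nil, pow_zero]
  | cons huw p ih =>
    rw [Walk.length_cons, pow_succ, ← ih, hs.eq_neg_of_adj huw]
    ring

theorem apply_mul_apply_eq_neg_one_pow_dist (hs : IsBipartiteSign G s) {u v : V}
    (hr : G.Reachable u v) : s u * s v = (-1) ^ G.dist u v := by
  obtain ⟨p, hp⟩ := hr.exists_walk_length_eq_dist
  rw [hs.apply_mul_apply p, hp]

theorem dotProduct_self [Fintype V] (hs : IsBipartiteSign G s) :
    s ⬝ᵥ s = Fintype.card V := by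
  simp [dotProduct, hs.mul_self]

theorem adjMatrix_mulVec_mul [Fintype V] [DecidableRel G.Adj] (hs : IsBipartiteSign G s)
    (v : V → ℝ) :
    G.adjMatrix ℝ *ᵥ (s * v) = -(s * G.adjMatrix ℝ *ᵥ v) := by
  ext u
  simp only [adjMatrix_mulVec_apply, Pi.neg_apply, Pi.mul_apply, mul_sum, ← sum_neg_distrib]
  refine sum_congr rfl fun w hw => ?_
  rw [hs.eq_neg_of_adj ((mem_neighborFinset _ _ _).1 hw), neg_mul]

end IsBipartiteSign

end BipartiteSign

section Spectrum

theorem vecMulVec_self_mulVec_eq_smul {n R : Type*} [Fintype n] [CommRing R] [IsDomain R]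
    [DecidableEq R] {A : Matrix n n R} (hA : A.IsSymm) {θ μ : R} {v w : n → R}
    (hw : A *ᵥ w = θ • w) (hsimple : ∀ v, A *ᵥ v = θ • v → ∃ c : R, v = c • w)
    (hv : A *ᵥ v = μ • v) :
    vecMulVec w w *ᵥ v = (if μ = θ then w ⬝ᵥ w else 0) • v := by
  rw [vecMulVec_mulVec, op_smul_eq_smul]
  split_ifs with hμ
  · obtain ⟨c, rfl⟩ := hsimple v (hμ ▸ hv)
    rw [dotProduct_smul, smul_smul, smul_eq_mul, mul_comm]
  · have horth : (μ - θ) * (w ⬝ᵥ v) = 0 := by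
      have h := dotProduct_mulVec w A v
      rw [← mulVec_transpose, hA.eq, hw, hv, dotProduct_smul, smul_dotProduct] at h
      rw [sub_mul, ← smul_eq_mul, ← smul_eq_mul, h, sub_self]
    rw [(mul_eq_zero.1 horth).resolve_left (sub_ne_zero.2 hμ), zero_smul, zero_smul]

theorem exists_eq_aeval_of_mulVec_eq_smul {n : Type*} [Fintype n] [DecidableEq n]
    {A B : Matrix n n ℝ} (hA : A.IsHermitian) {f : ℝ → ℝ}
    (h : ∀ μ v, A *ᵥ v = μ • v → B *ᵥ v = f μ • v) :
    ∃ p : Polynomial ℝ, B = Polynomial.aeval A p := by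
  let p := Lagrange.interpolate (univ.image hA.eigenvalues) id f
  refine ⟨p, Matrix.toEuclideanLin.injective (hA.eigenvectorBasis.toBasis.ext fun j => ?_)⟩
  have hj := hA.mulVec_eigenvectorBasis j
  have hp : p.eval (hA.eigenvalues j) = f (hA.eigenvalues j) :=
    Lagrange.eval_interpolate_at_node (v := id) f Function.injective_id.injOn
      (mem_image_of_mem _ (mem_univ j))
  rw [OrthonormalBasis.coe_toBasis, Matrix.toLpLin_apply, Matrix.toLpLin_apply, h _ _ hj,
    aeval_mulVec_eq_smul hj, hp]

variable {V : Type*} [Fintype V] {G : SimpleGraph V} [DecidableRel G.Adj] {k : ℕ} {v : V → ℝ}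

theorem exists_eq_smul_one_of_adjMatrix_mulVec_eq (hconn : G.Preconnected)
    (hreg : G.IsRegularOfDegree k) (hv : G.adjMatrix ℝ *ᵥ v = (k : ℝ) • v) :
    ∃ c : ℝ, v = c • 1 := by
  classical
  have hlap : G.lapMatrix ℝ *ᵥ v = 0 := by
    ext u
    have hu := congrFun hv u
    rw [adjMatrix_mulVec_apply, Pi.smul_apply, smul_eq_mul] at hu
    rw [lapMatrix_mulVec_apply, hreg u, hu, sub_self, Pi.zero_apply]
  rcases isEmpty_or_nonempty V with hV | ⟨⟨r⟩⟩
  · exact ⟨0, Subsingleton.elim _ _⟩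
  refine ⟨v r, funext fun u => ?_⟩
  rw [Pi.smul_apply, Pi.one_apply, smul_eq_mul, mul_one]
  exact G.lapMatrix_mulVec_eq_zero_iff_forall_reachable.1 hlap u r (hconn u r)

namespace IsBipartiteSign

variable {s : V → ℝ}

theorem adjMatrix_mulVec_self (hs : IsBipartiteSign G s) (hreg : G.IsRegularOfDegree k) :
    G.adjMatrix ℝ *ᵥ s = (-k : ℝ) • s := by
  rw [← mul_one s, hs.adjMatrix_mulVec_mul, adjMatrix_mulVec_one_of_regular hreg, mul_smul_comm,
    neg_smul]

theorem exists_eq_smul_of_adjMatrix_mulVec_eq (hs : IsBipartiteSign G s)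
    (hconn : G.Preconnected) (hreg : G.IsRegularOfDegree k)
    (hv : G.adjMatrix ℝ *ᵥ v = (-k : ℝ) • v) : ∃ c : ℝ, v = c • s := by
  have hss : s * s = 1 := funext hs.mul_self
  obtain ⟨c, hc⟩ := exists_eq_smul_one_of_adjMatrix_mulVec_eq (v := s * v) hconn hreg (by
    rw [hs.adjMatrix_mulVec_mul, hv, mul_smul_comm, neg_smul, neg_neg])
  refine ⟨c, ?_⟩
  rw [← one_mul v, ← hss, mul_assoc, hc, mul_smul_comm, mul_one]

end IsBipartiteSign

end Spectrum

section ExcessMatrix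

variable {V : Type*} [Fintype V] {G : SimpleGraph V} [DecidableRel G.Adj] {k d : ℕ} {s : V → ℝ}

theorem excessMatrix_eq_sub_aeval_polyH [DecidableEq V] (hreg : G.IsRegularOfDegree k)
    (hg : (2 * d : ℕ) ≤ G.egirth) (hd : 0 < d) (hdiam : ∀ u v, G.edist u v ≤ (d + 1 : ℕ))
    (hs : IsBipartiteSign G s) :
    excessMatrix G d = (1 / 2 : ℝ) • (vecMulVec 1 1 + (-1 : ℝ) ^ (d + 1) • vecMulVec s s) -
      Polynomial.aeval (G.adjMatrix ℝ) (polyH k (d - 1)) := by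
  ext u v
  obtain ⟨hr, hle⟩ := edist_le_natCast_iff.1 (hdiam u v)
  rw [Matrix.sub_apply, aeval_polyH_adjMatrix_apply hreg
    (lt_of_lt_of_le (by exact_mod_cast by lia) hg), excessMatrix, distanceMatrix, Matrix.of_apply,
    ← hr.coe_dist_eq_edist]
  simp only [Matrix.smul_apply, Matrix.add_apply, vecMulVec_apply, Pi.one_apply, smul_eq_mul,
    mul_one, hs.apply_mul_apply_eq_neg_one_pow_dist hr, ← pow_add, Nat.cast_inj, Nat.cast_le]
  rcases Nat.even_or_odd (d + 1 + G.dist u v) with h | h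
  · rw [h.neg_one_pow]
    rw [Nat.even_iff] at h
    split_ifs <;> first | lia | norm_num
  · rw [h.neg_one_pow]
    rw [Nat.odd_iff] at h
    split_ifs <;> first | lia | norm_num

theorem excessMatrix_mulVec_eq_smul (hconn : G.Preconnected) (hreg : G.IsRegularOfDegree k)
    (hg : (2 * d : ℕ) ≤ G.egirth) (hd : 0 < d) (hdiam : ∀ u v, G.edist u v ≤ (d + 1 : ℕ))
    (hs : IsBipartiteSign G s) {μ : ℝ} {v : V → ℝ} (hv : G.adjMatrix ℝ *ᵥ v = μ • v) :
    excessMatrix G d *ᵥ v =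
      ((1 / 2) * ((if μ = k then (Fintype.card V : ℝ) else 0) +
          (-1) ^ (d + 1) * (if μ = -k then (Fintype.card V : ℝ) else 0)) -
        (polyH k (d - 1)).eval μ) • v := by
  classical
  have hA : (G.adjMatrix ℝ).IsSymm := isSymm_adjMatrix G
  have hone := vecMulVec_self_mulVec_eq_smul hA (adjMatrix_mulVec_one_of_regular hreg)
    (fun _ => exists_eq_smul_one_of_adjMatrix_mulVec_eq hconn hreg) hv
  have hsign := vecMulVec_self_mulVec_eq_smul hA (hs.adjMatrix_mulVec_self hreg)
    (fun _ => hs.exists_eq_smul_of_adjMatrix_mulVec_eq hconn hreg) hv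
  rw [one_dotProduct_one] at hone
  rw [hs.dotProduct_self] at hsign
  rw [excessMatrix_eq_sub_aeval_polyH hreg hg hd hdiam hs, sub_mulVec, smul_mulVec, add_mulVec,
    smul_mulVec, hone, hsign, aeval_mulVec_eq_smul hv, smul_smul, ← add_smul, smul_smul,
    ← sub_smul]

end ExcessMatrix

section SmallExcess

variable {V : Type*} [Fintype V] {G : SimpleGraph V} [DecidableRel G.Adj] {k g d : ℕ} {e : ℤ}

theorem IsKGGraph.exists_adj (hG : IsKGGraph G k g) : ∃ x y, G.Adj x y := by
  by_contra! h
  have hbot : G = ⊥ := eq_bot_iff.2 fun x y hxy => (h x y hxy).elim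
  simpa [hbot] using hG.egirth_eq

namespace IsKGGraphOfExcess

theorem card_farFromEdge_add_one_lt (hG : IsKGGraphOfExcess G k (2 * d) e) (hd : 0 < d)
    (he : e + 2 ≤ k) {x y : V} (hxy : G.Adj x y) : #(farFromEdge G d x y) + 1 < k := by
  have := hG.card_farFromEdge hd hxy
  lia

theorem edist_le (hG : IsKGGraphOfExcess G k (2 * d) e) (hd : 0 < d) (he : e + 2 ≤ k)
    (u v : V) : G.edist u v ≤ (d + 1 : ℕ) := by
  obtain ⟨x, y, hxy⟩ := hG.exists_adj
  have hk : 0 < k := (Nat.zero_le _).trans_lt (hG.card_farFromEdge_add_one_lt hd he hxy)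
  obtain ⟨w, hvw⟩ := (G.degree_pos_iff_exists_adj v).1 ((hG.regular v).symm ▸ hk)
  exact edist_le_of_card_farFromEdge_lt hG.regular hvw
    (Nat.lt_of_succ_lt (hG.card_farFromEdge_add_one_lt hd he hvw)) u

theorem preconnected (hG : IsKGGraphOfExcess G k (2 * d) e) (hd : 0 < d) (he : e + 2 ≤ k) :
    G.Preconnected :=
  fun u v => (edist_le_natCast_iff.1 (hG.edist_le hd he u v)).1

theorem exists_isBipartiteSign (hG : IsKGGraphOfExcess G k (2 * d) e) (hd : 3 ≤ d)
    (he : e + 2 ≤ k) : ∃ s, IsBipartiteSign G s := by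
  have hpos : 0 < d := by lia
  obtain ⟨r, -, -⟩ := hG.exists_adj
  exact ⟨_, .neg_one_pow_dist (r := r) fun u v huv =>
    dist_ne_dist_of_adj_of_card_farFromEdge_lt (hG.preconnected hpos he) hG.regular
      hG.egirth_eq.ge hd huv (hG.card_farFromEdge_add_one_lt hpos he huv) r⟩

theorem exists_excessMatrix_mulVec_eq_smul (hG : IsKGGraphOfExcess G k (2 * d) e)
    (hd : 3 ≤ d) (he : e + 2 ≤ k) :
    ∃ f : ℝ → ℝ, (∀ μ : ℝ, μ ≠ k → μ ≠ -k → (polyH k (d - 1)).eval μ = -f μ) ∧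
      ∀ μ v, G.adjMatrix ℝ *ᵥ v = μ • v → excessMatrix G d *ᵥ v = f μ • v := by
  have hpos : 0 < d := by lia
  obtain ⟨s, hs⟩ := hG.exists_isBipartiteSign hd he
  refine ⟨_, fun μ hk hk' => ?_, fun μ v hv => excessMatrix_mulVec_eq_smul
    (hG.preconnected hpos he) hG.regular hG.egirth_eq.ge hpos (hG.edist_le hpos he) hs hv⟩
  rw [if_neg hk, if_neg hk', mul_zero, add_zero, mul_zero, zero_sub, neg_neg]

end IsKGGraphOfExcess

end SmallExcess

theorem mainTheorem2_general {V : Type*} [Fintype V] [DecidableEq V] (G : SimpleGraph V)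
    [DecidableRel G.Adj] (k d : ℕ) (e : ℤ) (he : e + 2 ≤ k) (hd : 3 ≤ d)
    (hG : IsKGGraphOfExcess G k (2 * d) e) :
    (∀ μ : ℝ, Module.End.HasEigenvalue (Matrix.toLin' (G.adjMatrix ℝ)) μ →
      μ ≠ (k : ℝ) → μ ≠ -(k : ℝ) →
      ∃ l : ℝ, Module.End.HasEigenvalue (Matrix.toLin' (excessMatrix G d)) l ∧
        (polyH k (d - 1)).eval μ = -l) ∧
    (∃ p : Polynomial ℝ, excessMatrix G d = Polynomial.aeval (G.adjMatrix ℝ) p) ∧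
    (∀ (μ : ℝ) (v : V → ℝ),
      Module.End.HasEigenvector (Matrix.toLin' (G.adjMatrix ℝ)) μ v →
      ∃ l : ℝ, Module.End.HasEigenvector (Matrix.toLin' (excessMatrix G d)) l v) := by
  obtain ⟨f, hf, hfv⟩ := hG.exists_excessMatrix_mulVec_eq_smul hd he
  have hvec (μ : ℝ) (v : V → ℝ)
      (hv : Module.End.HasEigenvector (Matrix.toLin' (G.adjMatrix ℝ)) μ v) :
      Module.End.HasEigenvector (Matrix.toLin' (excessMatrix G d)) (f μ) v :=
    ⟨Module.End.mem_eigenspace_iff.2 (hfv μ v hv.apply_eq_smul), hv.2⟩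
  refine ⟨fun μ hμ hk hk' => ?_, exists_eq_aeval_of_mulVec_eq_smul (G.isHermitian_adjMatrix ℝ) hfv,
    fun μ v hv => ⟨f μ, hvec μ v hv⟩⟩
  obtain ⟨v, hv⟩ := hμ.exists_hasEigenvector
  exact ⟨f μ, Module.End.hasEigenvalue_of_hasEigenvector (hvec μ v hv), hf μ hk hk'⟩

theorem mainTheorem2 {V : Type*} [Fintype V] [DecidableEq V] (G : SimpleGraph V)
    [DecidableRel G.Adj] (k d : ℕ) (hk : 6 ≤ k) (hd : 3 ≤ d)
    (hG : IsKGGraphOfExcess G k (2 * d) 4) :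
    (∀ μ : ℝ, Module.End.HasEigenvalue (Matrix.toLin' (G.adjMatrix ℝ)) μ →
      μ ≠ (k : ℝ) → μ ≠ -(k : ℝ) →
      ∃ l : ℝ, Module.End.HasEigenvalue (Matrix.toLin' (excessMatrix G d)) l ∧
        (polyH k (d - 1)).eval μ = -l) ∧
    (∃ p : Polynomial ℝ, excessMatrix G d = Polynomial.aeval (G.adjMatrix ℝ) p) ∧
    (∀ (μ : ℝ) (v : V → ℝ),
      Module.End.HasEigenvector (Matrix.toLin' (G.adjMatrix ℝ)) μ v →
      ∃ l : ℝ, Module.End.HasEigenvector (Matrix.toLin' (excessMatrix G d)) l v) :=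
  mainTheorem2_general G k d 4 (by lia) hd hG
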